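/- For integers $n\ge 1$ define $m(n)$ by $m(1),\dots,m(8)=1,2,4,4,8,8,8,8$ and $m(n+8)=16\,m(n)$. A quadratic harmonic morphism $\varphi:\mathbb R^{d}\to\mathbb R^{e}$ is a map whose components are homogeneous polynomials of degree $2$ (the zero polynomial is allowed) and such that for every open $U\subseteq\mathbb R^{e}$ and every harmonic $f:U\to\mathbb R$ the function $f\circ\varphi$ is harmonic on $\varphi^{-1}(U)$. Theorem. Let $n\ge 1$ and $k\ge 0$ be integers, put $m=m(n)$, and let $\varphi:\mathbb R^{2km}\to\mathbb R^{n+1}$ be a quadratic harmonic morphism that is not identically zero. Then, up to an orthogonal change of coordinates in the domain, $\varphi$ arises from a single quadratic function $F$, in the following sense. Let $F_0:\mathbb R^{2m}\to\mathbb R$ be $$F_0(x_1,\dots,x_{2m})=x_1^2+\dots+x_m^2-x_{m+1}^2-\dots-x_{2m}^2 .$$ There are constants $\lambda_1,\dots,\lambda_k\ge 0$, not all zero, such that, for the function $$F=\lambda_1F_0\oplus\dots\oplus\lambda_kF_0:\ \mathbb R^{2km}=\mathbb R^{2m}\times\dots\times\mathbb R^{2m}\to\mathbb R,\qquad F(X_1,\dots,X_k)=\sum_{j=1}^k\lambda_jF_0(X_j),$$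 the map $\varphi$ is domain-equivalent to a map $\psi=(\psi^1,\dots,\psi^{n+1})$, i.e. $\varphi=\psi\circ G$ for some $G\in O(\mathbb R^{2km})$, with $$\psi^1=F,\qquad \psi^i=F\circ G_i\quad(i=2,\dots,n+1)$$ for some $G_2,\dots,G_{n+1}\in O(\mathbb R^{2km})$. -/

import Mathlib

/-- A harmonic morphism between Euclidean spaces: a map that pulls back every harmonic function
defined on an open set `U` of the target to a harmonic function on the preimage of `U`.
(The values of `f` outside the open set `U` play no role.) -/
def IsHarmonicMorphism {d e : ℕ}
    (φ : EuclideanSpace ℝ (Fin d) → EuclideanSpace ℝ (Fin e)) : Prop :=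
  ∀ (U : Set (EuclideanSpace ℝ (Fin e))) (f : EuclideanSpace ℝ (Fin e) → ℝ), IsOpen U →
    InnerProductSpace.HarmonicOnNhd f U →
      InnerProductSpace.HarmonicOnNhd (f ∘ φ) (φ ⁻¹' U)

/-- A quadratic function on `ℝ^d`: a homogeneous polynomial of degree `2` in the coordinates
(the zero polynomial included). -/
def IsQuadraticFunction {d : ℕ} (f : EuclideanSpace ℝ (Fin d) → ℝ) : Prop :=
  ∃ p : MvPolynomial (Fin d) ℝ, p.IsHomogeneous 2 ∧ ∀ x, f x = MvPolynomial.eval (fun i => x i) p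

/-- A quadratic harmonic morphism: a harmonic morphism all of whose components are quadratic
functions. -/
def IsQuadraticHarmonicMorphism {d e : ℕ}
    (φ : EuclideanSpace ℝ (Fin d) → EuclideanSpace ℝ (Fin e)) : Prop :=
  IsHarmonicMorphism φ ∧ ∀ a : Fin e, IsQuadraticFunction (fun x => φ x a)

/-- The numbers `m(1), …, m(8) = 1, 2, 4, 4, 8, 8, 8, 8` and `m(n + 8) = 16 m(n)` for `n ≥ 1`.
The value at `0` is a placeholder and is not used. -/
def cliffordM : ℕ → ℕ
  | 0 => 0
  | 1 => 1
  | 2 => 2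
  | 3 => 4
  | 4 => 4
  | 5 => 8
  | 6 => 8
  | 7 => 8
  | 8 => 8
  | n + 9 => 16 * cliffordM (n + 1)

/-- `F₀(x₁, …, x_{2m}) = x₁² + ⋯ + x_m² - x_{m+1}² - ⋯ - x_{2m}²`. -/
noncomputable def quadF0 (m : ℕ) (x : EuclideanSpace ℝ (Fin (2 * m))) : ℝ :=
  ∑ i : Fin (2 * m), if i.val < m then x i ^ 2 else -(x i ^ 2)

/-- The `j`-th of the `k` consecutive blocks of `d` coordinates of a vector in
`ℝ^(k d) = ℝ^d × ⋯ × ℝ^d`; note that `finProdFinEquiv (j, i)` has value `i + d * j`. -/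
def euclideanBlock {k d : ℕ} (x : EuclideanSpace ℝ (Fin (k * d))) (j : Fin k) :
    EuclideanSpace ℝ (Fin d) :=
  WithLp.toLp 2 fun i => x (finProdFinEquiv (j, i))

/-- The direct sum `f₁ ⊕ ⋯ ⊕ f_k` of functions on `ℝ^d`, that is
`(x₁, …, x_k) ↦ f₁ x₁ + ⋯ + f_k x_k` on `ℝ^d × ⋯ × ℝ^d = ℝ^(k d)`. -/
noncomputable def directSumFun {k d : ℕ} (f : Fin k → EuclideanSpace ℝ (Fin d) → ℝ)
    (x : EuclideanSpace ℝ (Fin (k * d))) : ℝ :=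
  ∑ j : Fin k, f j (euclideanBlock x j)

/-- Domain-equivalence of maps: they differ by an orthogonal transformation of the domain. -/
def DomainEquivalent {d e : ℕ}
    (φ ψ : EuclideanSpace ℝ (Fin d) → EuclideanSpace ℝ (Fin e)) : Prop :=
  ∃ G : EuclideanSpace ℝ (Fin d) ≃ₗᵢ[ℝ] EuclideanSpace ℝ (Fin d), φ = ψ ∘ G

/-- A map `φ = (φ¹, …, φ^{n+1})` arises from the single function `F` if `φ¹ = F` and
`φ^i = F ∘ G_i` with `G_i` orthogonal, for `i = 2, …, n + 1`. -/
def ArisesFrom {d n : ℕ} (φ : EuclideanSpace ℝ (Fin d) → EuclideanSpace ℝ (Fin (n + 1)))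
    (F : EuclideanSpace ℝ (Fin d) → ℝ) : Prop :=
  (∀ x, φ x 0 = F x) ∧
    ∀ i : Fin n, ∃ G : EuclideanSpace ℝ (Fin d) ≃ₗᵢ[ℝ] EuclideanSpace ℝ (Fin d),
      ∀ x, φ x i.succ = F (G x)

/-! ### Dimensions of real Clifford modules. -/

section CliffordModules

set_option linter.unusedSimpArgs false

variable {V : Type*} [AddCommGroup V] [Module ℝ V] [FiniteDimensional ℝ V]

/-! Write each component as ⟪A_a x, x⟫ with A_a symmetric. Pulling back the harmonic functions y_a,
y_a y_b and y_a² - y_b² yields, after polarisation, A_a A_b = -A_b A_a for a ≠ b and A_a² = A_b².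

These relations control the spectrum. A_a + A_b intertwines A_a with A_b, so all A_a have the same
eigenvalue multiplicities (`finrank_eigenspace_le`). A_1 exchanges the ±μ eigenspaces of A_0
(`finrank_eigenspace_neg`). For μ ≠ 0, the rescaled products A_1 A_i, i ≥ 2, are n - 1 anticommuting
complex structures on the μ-eigenspace, so m(n) divides its dimension
(`cliffordM_dvd_finrank_eigenspace`, resting on `cliffordM_dvd_finrank`).

Hence the 2km eigenvalues split into k blocks of m copies each of λ_j and -λ_j. Diagonalising each
A_a separately gives φ^a = F ∘ G_a with one common F. -/

lemma Submodule.finrank_le_of_mapsTo (B : V →ₗ[ℝ] V) (E₁ E₂ : Submodule ℝ V)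
    (h : ∀ x ∈ E₁, B x ∈ E₂) (hB : ∀ x ∈ E₁, B x = 0 → x = 0) :
    Module.finrank ℝ E₁ ≤ Module.finrank ℝ E₂ := by
  refine LinearMap.finrank_le_finrank_of_injective (f := B.restrict h) ?_
  rw [← LinearMap.ker_eq_bot, LinearMap.ker_eq_bot']
  rintro ⟨x, hx⟩ hx0
  have := congrArg Subtype.val hx0
  simpa using! hB x hx (by simpa using! this)

/-- If an involution `T` of `W` anticommutes with a complex structure `J`, its fixed space has half
the dimension of `W`. -/
lemma finrank_eq_two_mul_finrank_fixed (T J : Module.End ℝ V) (W : Submodule ℝ V)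
    (hTW : ∀ x ∈ W, T x ∈ W) (hJW : ∀ x ∈ W, J x ∈ W) (hTT : T * T = 1) (hJJ : J * J = -1)
    (hTJ : T * J = -(J * T)) :
    Module.finrank ℝ W = 2 * Module.finrank ℝ (W ⊓ LinearMap.ker (T - 1) : Submodule ℝ V) := by
  have tt : ∀ x, T (T x) = x := fun x => by simpa using LinearMap.congr_fun hTT x
  have jj : ∀ x, J (J x) = -x := fun x => by simpa using LinearMap.congr_fun hJJ x
  have tj : ∀ x, T (J x) = -J (T x) := fun x => by simpa using LinearMap.congr_fun hTJ x
  have jinj : ∀ x, J x = 0 → x = 0 := fun x hx => by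
    have := jj x
    rw [hx, map_zero] at this
    simpa using this.symm
  set P : Submodule ℝ V := W ⊓ LinearMap.ker (T - 1) with hP
  set N : Submodule ℝ V := W ⊓ LinearMap.ker (T + 1) with hN
  have memP : ∀ x, x ∈ P ↔ x ∈ W ∧ T x = x := fun x => by simp [hP, sub_eq_zero]
  have memN : ∀ x, x ∈ N ↔ x ∈ W ∧ T x = -x := fun x => by simp [hN, add_eq_zero_iff_eq_neg]
  have hPN : Module.finrank ℝ P = Module.finrank ℝ N := by
    apply le_antisymm
    · refine Submodule.finrank_le_of_mapsTo J P N (fun x hx => ?_) fun x _ => jinj x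
      rw [memP] at hx
      exact (memN _).2 ⟨hJW x hx.1, by rw [tj, hx.2]⟩
    · refine Submodule.finrank_le_of_mapsTo J N P (fun x hx => ?_) fun x _ => jinj x
      rw [memN] at hx
      exact (memP _).2 ⟨hJW x hx.1, by rw [tj, hx.2, map_neg, neg_neg]⟩
  have hsup : P ⊔ N = W := by
    apply le_antisymm (sup_le inf_le_left inf_le_left)
    intro x hx
    refine Submodule.mem_sup.2 ⟨(2⁻¹ : ℝ) • (x + T x), (memP _).2 ⟨?_, ?_⟩,
      (2⁻¹ : ℝ) • (x - T x), (memN _).2 ⟨?_, ?_⟩, ?_⟩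
    · exact W.smul_mem _ (W.add_mem hx (hTW x hx))
    · rw [map_smul, map_add, tt, add_comm]
    · exact W.smul_mem _ (W.sub_mem hx (hTW x hx))
    · rw [map_smul, map_sub, tt, ← smul_neg, neg_sub]
    · module
  have hinf : P ⊓ N = ⊥ := by
    rw [eq_bot_iff]
    rintro x ⟨h1, h2⟩
    have h3 := ((memP x).1 h1).2
    have h4 := ((memN x).1 h2).2
    rw [h3] at h4
    have h5 : (2 : ℝ) • x = 0 := by rw [two_smul]; nth_rw 2 [h4]; exact add_neg_cancel x
    simpa using h5
  have := Submodule.finrank_sup_add_finrank_inf_eq P N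
  rw [hsup, hinf, finrank_bot, ← hPN] at this
  omega

/-- Taking determinants gives (det J)² = (-1)^dim. -/
lemma even_finrank_of_mul_self_eq_neg_one (J : Module.End ℝ V) (hJ : J * J = -1) :
    2 ∣ Module.finrank ℝ V := by
  have h : LinearMap.det J * LinearMap.det J = (-1) ^ Module.finrank ℝ V := by
    rw [← map_mul, hJ, ← neg_one_smul ℝ (1 : Module.End ℝ V), LinearMap.det_smul]
    simp
  by_contra hodd
  rw [(Nat.odd_iff.2 (by omega)).neg_one_pow] at h
  nlinarith [mul_self_nonneg (LinearMap.det J)]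

-- I, J and IJ make V a quaternionic vector space; count dimensions in the tower ℝ ⊂ ℍ.
open Quaternion in
omit [FiniteDimensional ℝ V] in
lemma four_dvd_finrank_of_anticommute (I J : Module.End ℝ V) (hI : I * I = -1) (hJ : J * J = -1)
    (hIJ : J * I = -(I * J)) : 4 ∣ Module.finrank ℝ V := by
  let q : QuaternionAlgebra.Basis (Module.End ℝ V) (-1 : ℝ) 0 (-1) :=
    { i := I, j := J, k := I * J
      i_mul_i := by simp [hI]
      j_mul_j := by simp [hJ]
      i_mul_j := rfl
      j_mul_i := by simp [hIJ] }
  let f : ℍ[ℝ] →ₐ[ℝ] Module.End ℝ V := QuaternionAlgebra.lift q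
  let _ : Module ℍ[ℝ] V := Module.compHom V f.toRingHom
  have _ : IsScalarTower ℝ ℍ[ℝ] V := ⟨fun r x v => by
    change f (r • x) v = r • f x v
    rw [map_smul]; rfl⟩
  have := Module.finrank_mul_finrank ℝ ℍ[ℝ] V
  rw [Quaternion.finrank_eq_four] at this
  exact ⟨_, this.symm⟩

lemma two_dvd_finrank_submodule (J : Module.End ℝ V) (W : Submodule ℝ V)
    (hJW : ∀ x ∈ W, J x ∈ W) (hJ : J * J = -1) : 2 ∣ Module.finrank ℝ W := by
  refine even_finrank_of_mul_self_eq_neg_one (J.restrict hJW) ?_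
  ext x
  simpa using LinearMap.congr_fun hJ (x : V)

omit [FiniteDimensional ℝ V] in
lemma four_dvd_finrank_submodule (I J : Module.End ℝ V) (W : Submodule ℝ V)
    (hIW : ∀ x ∈ W, I x ∈ W) (hJW : ∀ x ∈ W, J x ∈ W) (hI : I * I = -1) (hJ : J * J = -1)
    (hIJ : J * I = -(I * J)) : 4 ∣ Module.finrank ℝ W := by
  refine four_dvd_finrank_of_anticommute (I.restrict hIW) (J.restrict hJW) ?_ ?_ ?_
  · ext x
    simpa using LinearMap.congr_fun hI (x : V)
  · ext x
    simpa using LinearMap.congr_fun hJ (x : V)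
  · ext x
    simpa using LinearMap.congr_fun hIJ (x : V)

-- Operators commuting with T survive the passage to its fixed space, so successive cuts can be made
-- inside V.
omit [FiniteDimensional ℝ V] in
lemma mem_inf_ker_sub_one (T J : Module.End ℝ V) (W : Submodule ℝ V) (hJW : ∀ x ∈ W, J x ∈ W)
    (h : T * J = J * T) : ∀ x ∈ W ⊓ LinearMap.ker (T - 1), J x ∈ W ⊓ LinearMap.ker (T - 1) := by
  rintro x ⟨hx, hx'⟩
  refine ⟨hJW x hx, ?_⟩
  have h1 : T (J x) = J (T x) := LinearMap.congr_fun h x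
  have h2 : T x = x := by simpa [sub_eq_zero] using hx'
  simp [h1, h2]

/-- The involution `J₀ J₁ J₂` halves a module with four anticommuting complex structures. -/
lemma eight_dvd_finrank_submodule (J : ℕ → Module.End ℝ V) (W : Submodule ℝ V)
    (hW : ∀ i < 4, ∀ x ∈ W, J i x ∈ W) (hsq : ∀ i < 4, J i * J i = -1)
    (hanti : ∀ i j, j < i → i < 4 → J i * J j = -(J j * J i)) : 8 ∣ Module.finrank ℝ W := by
  have hsq' : ∀ i < 4, ∀ x, J i * (J i * x) = -x := fun i hi x => by
    rw [← mul_assoc, hsq i hi, neg_one_mul]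
  have hanti' : ∀ i j, j < i → i < 4 → ∀ x, J i * (J j * x) = -(J j * (J i * x)) :=
    fun i j hj hi x => by rw [← mul_assoc, hanti i j hj hi, neg_mul, mul_assoc]
  rw [finrank_eq_two_mul_finrank_fixed (J 0 * (J 1 * J 2)) (J 3) W
    (fun x hx => hW 0 (by simp) _ (hW 1 (by simp) _ (hW 2 (by simp) _ hx)))
    (hW 3 (by simp)) (by simp [mul_assoc, hsq, hsq', hanti, hanti']) (hsq 3 (by simp))
    (by simp [mul_assoc, hanti, hanti'])]
  refine mul_dvd_mul_left 2 (b := 4) (four_dvd_finrank_submodule (J 0) (J 1) _ ?_ ?_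
    (hsq 0 (by simp)) (hsq 1 (by simp)) (hanti 1 0 (by simp) (by simp)))
  · exact mem_inf_ker_sub_one _ _ _ (hW 0 (by simp))
      (by simp [mul_assoc, hsq, hsq', hanti, hanti'])
  · exact mem_inf_ker_sub_one _ _ _ (hW 1 (by simp))
      (by simp [mul_assoc, hsq, hsq', hanti, hanti'])

/-- The periodicity step: the four commuting involutions `J₀J₁J₂J₃`, `J₀J₁J₄J₅`, `J₀J₂J₄J₆`,
`J₄J₅J₆J₇` commute with all `J i`, `i ≥ 8`, and cut the dimension by `16`. -/
lemma exists_submodule_finrank_eq_sixteen_mul (r : ℕ) (J : ℕ → Module.End ℝ V)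
    (W : Submodule ℝ V) (hW : ∀ i < r + 8, ∀ x ∈ W, J i x ∈ W) (hsq : ∀ i < r + 8, J i * J i = -1)
    (hanti : ∀ i j, j < i → i < r + 8 → J i * J j = -(J j * J i)) :
    ∃ W' : Submodule ℝ V, Module.finrank ℝ W = 16 * Module.finrank ℝ W' ∧
      ∀ i < r, ∀ x ∈ W', J (i + 8) x ∈ W' := by
  have hW8 : ∀ i < 8, ∀ x ∈ W, J i x ∈ W := fun i hi => hW i (by omega)
  have sq : ∀ i < 8, J i * J i = -1 := fun i hi => hsq i (by omega)
  have sq' : ∀ i < 8, ∀ x, J i * (J i * x) = -x := fun i hi x => by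
    rw [← mul_assoc, sq i hi, neg_one_mul]
  have an : ∀ i j, j < i → i < 8 → J i * J j = -(J j * J i) := fun i j hj hi =>
    hanti i j hj (by omega)
  have an' : ∀ i j, j < i → i < 8 → ∀ x, J i * (J j * x) = -(J j * (J i * x)) :=
    fun i j hj hi x => by rw [← mul_assoc, an i j hj hi, neg_mul, mul_assoc]
  -- Moving past four anticommuting factors costs four signs, which cancel.
  have far : ∀ i < r, ∀ a < 8, ∀ b < 8, ∀ c < 8, ∀ d < 8,
      (J a * (J b * (J c * J d))) * J (i + 8) = J (i + 8) * (J a * (J b * (J c * J d))) := by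
    intro i hi a ha b hb c hc d hd
    have h1 : ∀ j < 8, J (i + 8) * J j = -(J j * J (i + 8)) := fun j hj =>
      hanti _ _ (by omega) (by omega)
    have h2 : ∀ j < 8, ∀ x, J (i + 8) * (J j * x) = -(J j * (J (i + 8) * x)) := fun j hj x => by
      rw [← mul_assoc, h1 j hj, neg_mul, mul_assoc]
    rw [h2 a ha, h2 b hb, h2 c hc, h1 d hd]
    simp [mul_assoc]
  set T₁ := J 0 * (J 1 * (J 2 * J 3)) with hT₁
  set T₂ := J 0 * (J 1 * (J 4 * J 5)) with hT₂
  set T₃ := J 0 * (J 2 * (J 4 * J 6)) with hT₃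
  set T₄ := J 4 * (J 5 * (J 6 * J 7)) with hT₄
  set W₁ := W ⊓ LinearMap.ker (T₁ - 1) with hW₁
  set W₂ := W₁ ⊓ LinearMap.ker (T₂ - 1) with hW₂
  set W₃ := W₂ ⊓ LinearMap.ker (T₃ - 1) with hW₃
  set W₄ := W₃ ⊓ LinearMap.ker (T₄ - 1) with hW₄
  have comp4 : ∀ a < 8, ∀ b < 8, ∀ c < 8, ∀ d < 8, ∀ x ∈ W,
      (J a * (J b * (J c * J d))) x ∈ W := fun a ha b hb c hc d hd x hx =>
    hW8 a ha _ (hW8 b hb _ (hW8 c hc _ (hW8 d hd _ hx)))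
  have t1W : ∀ x ∈ W, T₁ x ∈ W := comp4 0 (by simp) 1 (by simp) 2 (by simp) 3 (by simp)
  have t2W : ∀ x ∈ W, T₂ x ∈ W := comp4 0 (by simp) 1 (by simp) 4 (by simp) 5 (by simp)
  have t3W : ∀ x ∈ W, T₃ x ∈ W := comp4 0 (by simp) 2 (by simp) 4 (by simp) 6 (by simp)
  have t4W : ∀ x ∈ W, T₄ x ∈ W := comp4 4 (by simp) 5 (by simp) 6 (by simp) 7 (by simp)
  -- Any two of the four index sets meet in an even number of elements.
  have c12 : T₁ * T₂ = T₂ * T₁ := by simp [hT₁, hT₂, mul_assoc, sq, sq', an, an']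
  have c13 : T₁ * T₃ = T₃ * T₁ := by simp [hT₁, hT₃, mul_assoc, sq, sq', an, an']
  have c14 : T₁ * T₄ = T₄ * T₁ := by simp [hT₁, hT₄, mul_assoc, sq, sq', an, an']
  have c23 : T₂ * T₃ = T₃ * T₂ := by simp [hT₂, hT₃, mul_assoc, sq, sq', an, an']
  have c24 : T₂ * T₄ = T₄ * T₂ := by simp [hT₂, hT₄, mul_assoc, sq, sq', an, an']
  have c34 : T₃ * T₄ = T₄ * T₃ := by simp [hT₃, hT₄, mul_assoc, sq, sq', an, an']
  -- Each halving needs a J occurring in the current involution but in none of the earlier ones: J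
  -- 0, J 4, J 6, J 7 in turn.
  have h1 : Module.finrank ℝ W = 2 * Module.finrank ℝ W₁ :=
    finrank_eq_two_mul_finrank_fixed T₁ (J 0) W t1W (hW8 0 (by simp))
      (by simp [hT₁, mul_assoc, sq, sq', an, an']) (sq 0 (by simp))
      (by simp [hT₁, mul_assoc, sq, sq', an, an'])
  have h2 : Module.finrank ℝ W₁ = 2 * Module.finrank ℝ W₂ :=
    finrank_eq_two_mul_finrank_fixed T₂ (J 4) W₁ (mem_inf_ker_sub_one _ _ _ t2W c12)
      (mem_inf_ker_sub_one _ _ _ (hW8 4 (by simp)) (by simp [hT₁, mul_assoc, an, an']))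
      (by simp [hT₂, mul_assoc, sq, sq', an, an']) (sq 4 (by simp))
      (by simp [hT₂, mul_assoc, sq, sq', an, an'])
  have h3 : Module.finrank ℝ W₂ = 2 * Module.finrank ℝ W₃ :=
    finrank_eq_two_mul_finrank_fixed T₃ (J 6) W₂
      (mem_inf_ker_sub_one _ _ _ (mem_inf_ker_sub_one _ _ _ t3W c13) c23)
      (mem_inf_ker_sub_one _ _ _ (mem_inf_ker_sub_one _ _ _ (hW8 6 (by simp))
        (by simp [hT₁, mul_assoc, an, an'])) (by simp [hT₂, mul_assoc, an, an']))
      (by simp [hT₃, mul_assoc, sq, sq', an, an']) (sq 6 (by simp))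
      (by simp [hT₃, mul_assoc, sq, sq', an, an'])
  have h4 : Module.finrank ℝ W₃ = 2 * Module.finrank ℝ W₄ :=
    finrank_eq_two_mul_finrank_fixed T₄ (J 7) W₃
      (mem_inf_ker_sub_one _ _ _ (mem_inf_ker_sub_one _ _ _
        (mem_inf_ker_sub_one _ _ _ t4W c14) c24) c34)
      (mem_inf_ker_sub_one _ _ _ (mem_inf_ker_sub_one _ _ _ (mem_inf_ker_sub_one _ _ _
        (hW8 7 (by simp)) (by simp [hT₁, mul_assoc, an, an'])) (by simp [hT₂, mul_assoc, an, an']))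
        (by simp [hT₃, mul_assoc, an, an']))
      (by simp [hT₄, mul_assoc, sq, sq', an, an']) (sq 7 (by simp))
      (by simp [hT₄, mul_assoc, sq, sq', an, an'])
  refine ⟨W₄, by omega, fun i hi => ?_⟩
  exact mem_inf_ker_sub_one _ _ _ (mem_inf_ker_sub_one _ _ _ (mem_inf_ker_sub_one _ _ _
    (mem_inf_ker_sub_one _ _ _ (hW _ (by omega))
    (far i hi 0 (by simp) 1 (by simp) 2 (by simp) 3 (by simp)))
    (far i hi 0 (by simp) 1 (by simp) 4 (by simp) 5 (by simp)))
    (far i hi 0 (by simp) 2 (by simp) 4 (by simp) 6 (by simp)))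
    (far i hi 4 (by simp) 5 (by simp) 6 (by simp) 7 (by simp))

/-- A real vector space carrying `n` anticommuting complex structures has dimension divisible by
`m (n + 1)`. -/
theorem cliffordM_dvd_finrank (n : ℕ) (J : ℕ → Module.End ℝ V) (W : Submodule ℝ V)
    (hW : ∀ i < n, ∀ x ∈ W, J i x ∈ W) (hsq : ∀ i < n, J i * J i = -1)
    (hanti : ∀ i j, j < i → i < n → J i * J j = -(J j * J i)) :
    cliffordM (n + 1) ∣ Module.finrank ℝ W := by
  induction n using Nat.strong_induction_on generalizing J W with
  | _ n ih =>
    have four (h : 2 ≤ n) : 4 ∣ Module.finrank ℝ W :=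
      four_dvd_finrank_submodule (J 0) (J 1) W (hW 0 (by omega)) (hW 1 (by omega))
        (hsq 0 (by omega)) (hsq 1 (by omega)) (hanti 1 0 (by omega) (by omega))
    have eight (h : 4 ≤ n) : 8 ∣ Module.finrank ℝ W :=
      eight_dvd_finrank_submodule J W (fun i hi => hW i (by omega)) (fun i hi => hsq i (by omega))
        fun i j hj hi => hanti i j hj (by omega)
    rcases lt_or_ge n 8 with h | h
    -- Three structures give no more than two do, and five to seven no more than four, matching the
    -- plateaus 4, 4 and 8, 8, 8, 8.
    · interval_cases n
      · exact one_dvd _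
      · exact two_dvd_finrank_submodule (J 0) W (hW 0 (by simp)) (hsq 0 (by simp))
      · exact four (by simp)
      · exact four (by simp)
      · exact eight (by simp)
      · exact eight (by simp)
      · exact eight (by simp)
      · exact eight (by simp)
    · obtain ⟨r, rfl⟩ := Nat.exists_eq_add_of_le' h
      obtain ⟨W', hdim, hW'⟩ := exists_submodule_finrank_eq_sixteen_mul r J W hW hsq hanti
      rw [hdim]
      exact mul_dvd_mul_left 16 (ih r (by omega) (fun i => J (i + 8)) W' hW'
        (fun i hi => hsq _ (by omega)) fun i j hj hi => hanti _ _ (by omega) (by omega))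

end CliffordModules

/-! ### From harmonic morphisms to operator identities. -/

section HarmonicMorphisms

open InnerProductSpace Laplacian

variable {E : Type*} [NormedAddCommGroup E] [InnerProductSpace ℝ E] [FiniteDimensional ℝ E]

lemma laplacian_eq_sum_fderiv_fderiv {ι : Type*} [Fintype ι] (v : OrthonormalBasis ι ℝ E)
    (f : E → ℝ) (x : E) : Δ f x = ∑ i, fderiv ℝ (fderiv ℝ f) x (v i) (v i) := by
  simp [laplacian_eq_iteratedFDeriv_orthonormalBasis f v, iteratedFDeriv_two_apply]

lemma laplacian_mul {ι : Type*} [Fintype ι] (v : OrthonormalBasis ι ℝ E) {f g : E → ℝ}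
    (hf : ContDiff ℝ 2 f) (hg : ContDiff ℝ 2 g) (x : E) :
    Δ (fun y => f y * g y) x =
      f x * Δ g x + g x * Δ f x + 2 * ∑ i, fderiv ℝ f x (v i) * fderiv ℝ g x (v i) := by
  have df : Differentiable ℝ f := hf.differentiable (by simp)
  have dg : Differentiable ℝ g := hg.differentiable (by simp)
  have ddf : Differentiable ℝ (fderiv ℝ f) :=
    (hf.fderiv_right (m := 1) (by norm_num)).differentiable (by simp)
  have ddg : Differentiable ℝ (fderiv ℝ g) :=
    (hg.fderiv_right (m := 1) (by norm_num)).differentiable (by simp)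
  have h1 : fderiv ℝ (fun y => f y * g y) = fun y => f y • fderiv ℝ g y + g y • fderiv ℝ f y :=
    funext fun y => ((df y).hasFDerivAt.mul (dg y).hasFDerivAt).fderiv
  have h2 := (((df x).hasFDerivAt.smul (ddg x).hasFDerivAt).add
    ((dg x).hasFDerivAt.smul (ddf x).hasFDerivAt)).fderiv
  simp only [laplacian_eq_sum_fderiv_fderiv v]
  rw [h1]
  simp only [Finset.mul_sum, ← Finset.sum_add_distrib]
  refine Finset.sum_congr rfl fun i _ => ?_
  erw [h2]
  simp
  ring

lemma laplacian_continuousLinearMap (l : E →L[ℝ] ℝ) (x : E) : Δ (fun y => l y) x = 0 := by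
  have h : fderiv ℝ (fun y => l y) = fun _ => l := funext fun y => l.fderiv
  rw [laplacian_eq_sum_fderiv_fderiv (stdOrthonormalBasis ℝ E), h]
  simp

lemma hasFDerivAt_inner_map_self {A : E →ₗ[ℝ] E} (hA : A.IsSymmetric) (x : E) :
    HasFDerivAt (fun y => inner ℝ (A y) y) ((2 : ℝ) • innerSL ℝ (A x)) x := by
  have h := ((LinearMap.toContinuousLinearMap A).hasFDerivAt (x := x)).inner ℝ (hasFDerivAt_id x)
  refine h.congr_fderiv ?_
  ext v
  simp [fderivInnerCLM_apply, two_mul, hA v x, real_inner_comm]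

lemma contDiff_inner_map_self (A : E →ₗ[ℝ] E) (n : WithTop ℕ∞) :
    ContDiff ℝ n (fun y => inner ℝ (A y) y) :=
  (LinearMap.toContinuousLinearMap A).contDiff.inner ℝ contDiff_id

/-- Only the gradient term of the product rule survives; the gradients are 2Ax and 2Bx, whence 8 = 2
· 2 · 2. -/
lemma laplacian_mul_inner_map_self {A B : E →ₗ[ℝ] E} (hA : A.IsSymmetric) (hB : B.IsSymmetric)
    (hA0 : ∀ x, Δ (fun y => inner ℝ (A y) y) x = 0) (hB0 : ∀ x, Δ (fun y => inner ℝ (B y) y) x = 0)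
    (x : E) : Δ (fun y => inner ℝ (A y) y * inner ℝ (B y) y) x = 8 * inner ℝ (A x) (B x) := by
  rw [laplacian_mul (stdOrthonormalBasis ℝ E) (contDiff_inner_map_self A 2)
    (contDiff_inner_map_self B 2), hA0, hB0,
    ← (stdOrthonormalBasis ℝ E).sum_inner_mul_inner (A x) (B x)]
  simp only [(hasFDerivAt_inner_map_self hA x).fderiv, (hasFDerivAt_inner_map_self hB x).fderiv,
    Finset.mul_sum, mul_zero, zero_add]
  refine Finset.sum_congr rfl fun i _ => ?_
  simp only [_root_.smul_apply, innerSL_apply_apply, smul_eq_mul]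
  rw [real_inner_comm (B x)]
  ring

lemma laplacian_coord {e : ℕ} (a : Fin e) (x : EuclideanSpace ℝ (Fin e)) :
    Δ (fun y : EuclideanSpace ℝ (Fin e) => y a) x = 0 :=
  laplacian_continuousLinearMap (EuclideanSpace.proj a) x

lemma contDiff_coord {e : ℕ} (a : Fin e) (n : WithTop ℕ∞) :
    ContDiff ℝ n (fun y : EuclideanSpace ℝ (Fin e) => y a) :=
  (EuclideanSpace.proj a : EuclideanSpace ℝ (Fin e) →L[ℝ] ℝ).contDiff

lemma laplacian_coord_mul_coord {e : ℕ} (a b : Fin e) (x : EuclideanSpace ℝ (Fin e)) :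
    Δ (fun y : EuclideanSpace ℝ (Fin e) => y a * y b) x = if a = b then 2 else 0 := by
  have h : ∀ a : Fin e, fderiv ℝ (fun y : EuclideanSpace ℝ (Fin e) => y a) x =
      EuclideanSpace.proj a := fun a =>
    (EuclideanSpace.proj a : EuclideanSpace ℝ (Fin e) →L[ℝ] ℝ).fderiv
  rw [laplacian_mul (EuclideanSpace.basisFun (Fin e) ℝ) (contDiff_coord a 2) (contDiff_coord b 2),
    laplacian_coord, laplacian_coord, h, h]
  simp

lemma harmonicOnNhd_univ {f : E → ℝ} (hf : ContDiff ℝ 2 f) (h : ∀ x, Δ f x = 0) :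
    HarmonicOnNhd f Set.univ :=
  fun _ _ => ⟨hf.contDiffAt, Filter.Eventually.of_forall h⟩

lemma InnerProductSpace.HarmonicOnNhd.laplacian_eq_zero {f : E → ℝ} {U : Set E}
    (h : HarmonicOnNhd f U) {x : E} (hx : x ∈ U) : Δ f x = 0 :=
  (h x hx).2.eq_of_nhds

section Morphism

variable {d e : ℕ} {φ : EuclideanSpace ℝ (Fin d) → EuclideanSpace ℝ (Fin e)}

/-- Test functions defined on the whole target suffice for the argument. -/
lemma IsHarmonicMorphism.laplacian_comp (hφ : IsHarmonicMorphism φ)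
    {f : EuclideanSpace ℝ (Fin e) → ℝ} (hf : ContDiff ℝ 2 f) (h : ∀ y, Δ f y = 0)
    (x : EuclideanSpace ℝ (Fin d)) : Δ (fun y => f (φ y)) x = 0 :=
  (hφ Set.univ f isOpen_univ (harmonicOnNhd_univ hf h)).laplacian_eq_zero (Set.mem_univ _)

variable {A : Fin e → EuclideanSpace ℝ (Fin d) →ₗ[ℝ] EuclideanSpace ℝ (Fin d)}

lemma IsHarmonicMorphism.laplacian_component (hφ : IsHarmonicMorphism φ)
    (hAφ : ∀ a x, φ x a = inner ℝ (A a x) x) (a : Fin e) (x : EuclideanSpace ℝ (Fin d)) :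
    Δ (fun y => inner ℝ (A a y) y) x = 0 := by
  simpa only [hAφ] using hφ.laplacian_comp (contDiff_coord a 2) (laplacian_coord a) x

/-- Test against y_a y_b. -/
lemma IsHarmonicMorphism.inner_eq_zero (hφ : IsHarmonicMorphism φ)
    (hA : ∀ a, (A a).IsSymmetric) (hAφ : ∀ a x, φ x a = inner ℝ (A a x) x) {a b : Fin e}
    (hab : a ≠ b) (x : EuclideanSpace ℝ (Fin d)) : inner ℝ (A a x) (A b x) = 0 := by
  have h := hφ.laplacian_comp ((contDiff_coord a 2).mul (contDiff_coord b 2))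
    (fun y => by rw [laplacian_coord_mul_coord, if_neg hab]) x
  simp only [hAφ] at h
  rw [laplacian_mul_inner_map_self (hA a) (hA b) (hφ.laplacian_component hAφ a)
    (hφ.laplacian_component hAφ b)] at h
  linarith

/-- Test against y_a² - y_b². -/
lemma IsHarmonicMorphism.inner_self_eq (hφ : IsHarmonicMorphism φ)
    (hA : ∀ a, (A a).IsSymmetric) (hAφ : ∀ a x, φ x a = inner ℝ (A a x) x) (a b : Fin e)
    (x : EuclideanSpace ℝ (Fin d)) :
    inner ℝ (A a x) (A a x) = inner ℝ (A b x) (A b x) := by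
  have hc : ∀ a : Fin e, ContDiff ℝ 2 fun y : EuclideanSpace ℝ (Fin e) => y a * y a :=
    fun a => (contDiff_coord a 2).mul (contDiff_coord a 2)
  have hq : ∀ a, ContDiff ℝ 2 fun y => inner ℝ (A a y) y * inner ℝ (A a y) y :=
    fun a => (contDiff_inner_map_self (A a) 2).mul (contDiff_inner_map_self (A a) 2)
  have h := hφ.laplacian_comp ((hc a).sub (hc b)) (fun y => by
    refine ((hc a).contDiffAt.laplacian_sub (hc b).contDiffAt).trans ?_
    simp [laplacian_coord_mul_coord]) x
  simp only [hAφ] at h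
  have h2 := ((hq a).contDiffAt (x := x)).laplacian_sub ((hq b).contDiffAt (x := x))
  rw [laplacian_mul_inner_map_self (hA a) (hA a) (hφ.laplacian_component hAφ a)
    (hφ.laplacian_component hAφ a), laplacian_mul_inner_map_self (hA b) (hA b)
    (hφ.laplacian_component hAφ b) (hφ.laplacian_component hAφ b)] at h2
  have h3 := h.symm.trans h2
  linarith

/-- A symmetric operator with vanishing quadratic form is zero; apply this to A_a A_b + A_b A_a. -/
lemma IsHarmonicMorphism.anticommute (hφ : IsHarmonicMorphism φ)
    (hA : ∀ a, (A a).IsSymmetric) (hAφ : ∀ a x, φ x a = inner ℝ (A a x) x) {a b : Fin e}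
    (hab : a ≠ b) (x : EuclideanSpace ℝ (Fin d)) : A a (A b x) = -A b (A a x) := by
  have hs : (A a ∘ₗ A b + A b ∘ₗ A a).IsSymmetric := fun x y => by
    simp only [LinearMap.add_apply, LinearMap.comp_apply, inner_add_left, inner_add_right,
      hA a _ _, hA b _ _]
    ring
  have h := hs.inner_map_self_eq_zero.1 fun x => by
    simp only [LinearMap.add_apply, LinearMap.comp_apply, inner_add_left, hA a _ x, hA b _ x,
      hφ.inner_eq_zero hA hAφ hab, hφ.inner_eq_zero hA hAφ hab.symm, add_zero]
  exact eq_neg_of_add_eq_zero_left (LinearMap.congr_fun h x)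

lemma IsHarmonicMorphism.sq_eq (hφ : IsHarmonicMorphism φ)
    (hA : ∀ a, (A a).IsSymmetric) (hAφ : ∀ a x, φ x a = inner ℝ (A a x) x) (a b : Fin e)
    (x : EuclideanSpace ℝ (Fin d)) : A a (A a x) = A b (A b x) := by
  have hs : (A a ∘ₗ A a - A b ∘ₗ A b).IsSymmetric := fun x y => by
    simp only [LinearMap.sub_apply, LinearMap.comp_apply, inner_sub_left, inner_sub_right,
      hA a _ _, hA b _ _]
  have h := hs.inner_map_self_eq_zero.1 fun x => by
    simp only [LinearMap.sub_apply, LinearMap.comp_apply, inner_sub_left, hA a _ x, hA b _ x,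
      hφ.inner_self_eq hA hAφ a b, sub_self]
  exact sub_eq_zero.1 (LinearMap.congr_fun h x)

end Morphism

/-- Every quadratic function is `x ↦ ⟪A x, x⟫` for a symmetric operator `A`. -/
lemma IsQuadraticFunction.exists_isSymmetric {d : ℕ} {f : EuclideanSpace ℝ (Fin d) → ℝ}
    (hf : IsQuadraticFunction f) :
    ∃ A : EuclideanSpace ℝ (Fin d) →ₗ[ℝ] EuclideanSpace ℝ (Fin d), A.IsSymmetric ∧
      ∀ x, f x = inner ℝ (A x) x := by
  obtain ⟨p, hp, hfp⟩ := hf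
  have mono : ∀ s ∈ p.support, ∃ A : EuclideanSpace ℝ (Fin d) →ₗ[ℝ] EuclideanSpace ℝ (Fin d),
      A.IsSymmetric ∧
        ∀ x : EuclideanSpace ℝ (Fin d), MvPolynomial.eval (fun i => x i)
          (MvPolynomial.monomial s (p.coeff s)) = inner ℝ (A x) x := by
    intro s hs
    have hdeg : s.degree = 2 := by
      rw [Finsupp.degree_eq_weight_one]
      exact hp (MvPolynomial.mem_support_iff.1 hs)
    have hcard : (Finsupp.toMultiset s).card = 2 := by
      rw [Finsupp.card_toMultiset]; exact hdeg
    obtain ⟨i, j, hij⟩ := Multiset.card_eq_two.1 hcard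
    have hs' : s = Finsupp.single i 1 + Finsupp.single j 1 := by
      rw [← Finsupp.toMultiset_toFinsupp s, hij, Multiset.insert_eq_cons,
        ← Multiset.singleton_add, map_add]
      simp
    let e : Fin d → EuclideanSpace ℝ (Fin d) := fun i => EuclideanSpace.single i 1
    let l : Fin d → EuclideanSpace ℝ (Fin d) →ₗ[ℝ] ℝ := fun i => (innerSL ℝ (e i)).toLinearMap
    -- The symmetrised rank-one operator of the monomial x_i x_j; i = j is allowed, and then the two
    -- halves add up.
    refine ⟨(p.coeff s / 2) • ((l i).smulRight (e j) + (l j).smulRight (e i)), ?_, ?_⟩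
    · intro x y
      simp [l, e, inner_add_left, inner_add_right, real_inner_smul_left, real_inner_smul_right,
        EuclideanSpace.inner_single_left, EuclideanSpace.inner_single_right]
      ring
    · intro x
      rw [MvPolynomial.eval_monomial, hs', Finsupp.prod_add_index' (by simp) (by simp [pow_add])]
      simp [l, e, inner_add_left, real_inner_smul_left, EuclideanSpace.inner_single_left]
      ring
  choose! A hA hAx using mono
  refine ⟨∑ s ∈ p.support, A s, ?_, fun x => ?_⟩
  · intro x y
    simp only [LinearMap.sum_apply, sum_inner, inner_sum]
    exact Finset.sum_congr rfl fun s hs => hA s hs x y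
  · rw [hfp, MvPolynomial.as_sum p, map_sum, LinearMap.sum_apply, sum_inner, ← MvPolynomial.as_sum p]
    exact Finset.sum_congr rfl fun s hs => hAx s hs x

end HarmonicMorphisms

/-! ### Combinatorics of the eigenvalue multiset. -/

section Multisets

/-- Corresponding fibres have equal cardinality; glue bijections between them. -/
lemma exists_perm_of_map_eq {ι β : Type*} [Fintype ι] [DecidableEq β] (f g : ι → β)
    (h : Finset.univ.val.map f = Finset.univ.val.map g) : ∃ σ : Equiv.Perm ι, ∀ i, g (σ i) = f i := by
  have hcard : ∀ y, Fintype.card {i // f i = y} = Fintype.card {i // g i = y} := fun y => by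
    have := congrArg (Multiset.count y) h
    rw [Multiset.count_map, Multiset.count_map] at this
    rw [Fintype.card_subtype, Fintype.card_subtype]
    simpa [Finset.card, Finset.filter_val, eq_comm] using this
  refine ⟨(Equiv.sigmaFiberEquiv f).symm.trans ((Equiv.sigmaCongrRight fun y =>
    Fintype.equivOfCardEq (hcard y)).trans (Equiv.sigmaFiberEquiv g)), fun i => ?_⟩
  exact (Fintype.equivOfCardEq (hcard (f i)) ⟨i, rfl⟩).2

/-- A multiset symmetric under negation, whose nonzero elements have multiplicities divisible by
`m`, and of cardinality `2 k m`, is a union of `k` blocks `m {c}, m {-c}`. -/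
lemma exists_eq_sum_replicate {m : ℕ} (k : ℕ) (M : Multiset ℝ)
    (hcard : M.card = k * (2 * m)) (hneg : ∀ μ, μ ≠ 0 → M.count (-μ) = M.count μ)
    (hdvd : ∀ μ, μ ≠ 0 → m ∣ M.count μ) :
    ∃ c : Fin k → ℝ, (∀ j, 0 ≤ c j) ∧
      M = ∑ j, (Multiset.replicate m (c j) + Multiset.replicate m (-c j)) := by
  induction k generalizing M with
  | zero =>
    have h0 : M.card = 0 := by simpa using hcard
    exact ⟨fun _ => 0, fun _ => le_rfl, by simpa using h0⟩
  | succ k ih =>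
    by_cases hM : ∃ μ ∈ M, μ ≠ 0
    -- Peel off one block at a positive μ; the remainder inherits symmetry and divisibility.
    · have hpos : ∃ μ ∈ M, 0 < μ := by
        obtain ⟨μ, hμ, hμ0⟩ := hM
        rcases hμ0.lt_or_gt with h | h
        · refine ⟨-μ, ?_, by linarith⟩
          rw [← Multiset.count_pos, hneg μ hμ0]
          exact Multiset.count_pos.2 hμ
        · exact ⟨μ, hμ, h⟩
      obtain ⟨μ, hμ, hμ0⟩ := hpos
      have hμm : m ≤ M.count μ := Nat.le_of_dvd (Multiset.count_pos.2 hμ) (hdvd μ hμ0.ne')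
      have hne : μ ≠ -μ := by intro h; linarith
      have hle : Multiset.replicate m μ + Multiset.replicate m (-μ) ≤ M := by
        rw [Multiset.le_iff_count]
        intro ν
        rw [Multiset.count_add, Multiset.count_replicate, Multiset.count_replicate]
        split_ifs with h1 h2 h2
        · exact absurd (h1.trans h2.symm) hne
        · subst h1; simpa using hμm
        · subst h2; rw [hneg _ hμ0.ne']; simpa using hμm
        · simp
      obtain ⟨N, rfl⟩ := Multiset.le_iff_exists_add.1 hle
      have hcount : ∀ ν, (Multiset.replicate m μ + Multiset.replicate m (-μ)).count (-ν) =
          (Multiset.replicate m μ + Multiset.replicate m (-μ)).count ν := fun ν => by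
        simp only [Multiset.count_add, Multiset.count_replicate, neg_inj, ← neg_eq_iff_eq_neg (a := μ)]
        rw [add_comm]
      obtain ⟨c, hc, hN⟩ := ih N
        (by
          simp only [Multiset.card_add, Multiset.card_replicate] at hcard
          rw [add_mul] at hcard
          omega)
        (fun ν hν => by
          have := hneg ν hν
          rw [Multiset.count_add _ _ N, Multiset.count_add _ _ N, hcount] at this
          exact Nat.add_left_cancel this)
        (fun ν hν => by
          have := hdvd ν hν
          rw [Multiset.count_add] at this
          refine (Nat.dvd_add_right ?_).1 this
          rw [Multiset.count_add, Multiset.count_replicate, Multiset.count_replicate]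
          split_ifs <;> simp)
      refine ⟨Fin.cons μ c, Fin.cases hμ0.le hc, ?_⟩
      rw [Fin.sum_univ_succ]
      simp [hN]
    -- Only zeros remain, and the cardinality alone makes them fill the remaining blocks, so the
    -- multiplicity of 0 needs no divisibility.
    · push Not at hM
      refine ⟨fun _ => 0, fun _ => le_rfl, ?_⟩
      rw [Multiset.eq_replicate_card.2 hM, hcard]
      simp [← Multiset.replicate_add, ← two_mul, Multiset.nsmul_replicate]

lemma map_univ_block_signs (k m : ℕ) (c : Fin k → ℝ) :
    (Finset.univ : Finset (Fin (k * (2 * m)))).val.map (fun t =>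
      if (finProdFinEquiv.symm t).2.val < m then c (finProdFinEquiv.symm t).1
        else -c (finProdFinEquiv.symm t).1) =
      ∑ j, (Multiset.replicate m (c j) + Multiset.replicate m (-c j)) := by
  have h (d : Fin (k * (2 * m)) → ℝ) : Finset.univ.val.map d = ∑ t, {d t} := by
    rw [Finset.sum_eq_multiset_sum, ← Multiset.sum_map_singleton (Finset.univ.val.map d),
      Multiset.map_map]
    rfl
  rw [h, ← Equiv.sum_comp finProdFinEquiv, Fintype.sum_prod_type]
  refine Finset.sum_congr rfl fun j _ => ?_
  simp only [Equiv.symm_apply_apply]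
  rw [Fin.sum_univ_eq_sum_range (fun i => ({if i < m then c j else -c j} : Multiset ℝ)) (2 * m),
    two_mul, Finset.sum_range_add]
  congr 1
  · rw [Finset.sum_congr rfl fun i hi => by rw [if_pos (Finset.mem_range.1 hi)]]
    simp [Multiset.nsmul_singleton]
  · rw [Finset.sum_congr rfl fun i hi => by rw [if_neg (by omega)]]
    simp [Multiset.nsmul_singleton]

end Multisets

/-! ### Spectra of anticommuting symmetric operators with equal squares. -/

section CliffordSystems

variable {E : Type*} [NormedAddCommGroup E] [InnerProductSpace ℝ E] [FiniteDimensional ℝ E]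

open Module.End

/-- Q carries the μ-eigenspace of P into the -μ one, injectively because Q² = P² = μ² there. -/
lemma finrank_eigenspace_le_neg {P Q : E →ₗ[ℝ] E} (hanti : ∀ x, P (Q x) = -Q (P x))
    (hsq : ∀ x, P (P x) = Q (Q x)) {μ : ℝ} (hμ : μ ≠ 0) :
    Module.finrank ℝ (eigenspace P μ) ≤ Module.finrank ℝ (eigenspace P (-μ)) := by
  refine Submodule.finrank_le_of_mapsTo Q _ _ (fun x hx => ?_) fun x hx hx0 => ?_
  · rw [mem_eigenspace_iff] at hx ⊢
    rw [hanti, hx, map_smul, neg_smul]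
  · rw [mem_eigenspace_iff] at hx
    have := hsq x
    rw [hx0, map_zero, hx, map_smul, hx, smul_smul] at this
    simpa [hμ] using this

lemma finrank_eigenspace_neg {P Q : E →ₗ[ℝ] E} (hanti : ∀ x, P (Q x) = -Q (P x))
    (hsq : ∀ x, P (P x) = Q (Q x)) {μ : ℝ} (hμ : μ ≠ 0) :
    Module.finrank ℝ (eigenspace P (-μ)) = Module.finrank ℝ (eigenspace P μ) := by
  refine le_antisymm ?_ (finrank_eigenspace_le_neg hanti hsq hμ)
  have h := finrank_eigenspace_le_neg hanti hsq (neg_ne_zero.2 hμ)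
  rwa [neg_neg] at h

/-- `P + Q` intertwines two anticommuting operators with the same square. -/
lemma finrank_eigenspace_le {P Q : E →ₗ[ℝ] E} (hQ : Q.IsSymmetric)
    (hanti : ∀ x, P (Q x) = -Q (P x)) (hsq : ∀ x, P (P x) = Q (Q x)) (μ : ℝ) :
    Module.finrank ℝ (eigenspace P μ) ≤ Module.finrank ℝ (eigenspace Q μ) := by
  -- P + Q need not be injective on the kernel of P; there, symmetry of Q gives ker Q² = ker Q
  -- instead.
  rcases eq_or_ne μ 0 with rfl | hμ
  · refine Submodule.finrank_mono fun x hx => ?_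
    rw [mem_eigenspace_iff, zero_smul] at hx ⊢
    have h : Q (Q x) = 0 := by rw [← hsq, hx, map_zero]
    rw [← inner_self_eq_zero (𝕜 := ℝ), hQ, h, inner_zero_right]
  · refine Submodule.finrank_le_of_mapsTo (P + Q) _ _ (fun x hx => ?_) fun x hx hx0 => ?_
    · rw [mem_eigenspace_iff] at hx ⊢
      have h1 : Q (P x) = -P (Q x) := by rw [hanti, neg_neg]
      have h2 : P (Q x) = -(μ • Q x) := by rw [hanti, hx, map_smul]
      rw [LinearMap.add_apply, map_add, h1, h2, ← hsq, hx, map_smul, hx, neg_neg, smul_add,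
        add_comm]
    · rw [mem_eigenspace_iff] at hx
      -- The cross terms cancel, so (P + Q)² = 2P², which gives injectivity for μ ≠ 0.
      have h1 : (P + Q) ((P + Q) x) = (2 * (μ * μ)) • x := by
        simp only [LinearMap.add_apply, map_add, hanti, ← hsq]
        simp only [hx, map_smul]
        module
      rw [hx0, map_zero] at h1
      simpa [hμ] using h1.symm

/-- A_1 A_i (i ≥ 2) commutes with A_0 and squares to -μ⁴ on the eigenspace; the factor μ⁻²
normalises it to a complex structure. -/
lemma cliffordM_dvd_finrank_eigenspace (r : ℕ) (A : Fin (r + 2) → E →ₗ[ℝ] E)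
    (hanti : ∀ a b, a ≠ b → ∀ x, A a (A b x) = -A b (A a x))
    (hsq : ∀ a b x, A a (A a x) = A b (A b x)) {μ : ℝ} (hμ : μ ≠ 0) :
    cliffordM (r + 1) ∣ Module.finrank ℝ (eigenspace (A 0) μ) := by
  have maps : ∀ i : Fin r, ∀ x ∈ eigenspace (A 0) μ,
      ((μ ^ 2)⁻¹ • (A 1 ∘ₗ A i.succ.succ)) x ∈ eigenspace (A 0) μ := by
    intro i x hx
    rw [mem_eigenspace_iff] at hx ⊢
    have h1 : A 0 (A 1 (A i.succ.succ x)) = A 1 (A i.succ.succ (A 0 x)) := by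
      rw [hanti 0 1 (by simp), hanti 0 i.succ.succ (Fin.succ_ne_zero _).symm, map_neg, neg_neg]
    simp only [LinearMap.smul_apply, LinearMap.comp_apply, map_smul, h1, hx]
    rw [smul_comm]
  let T : Fin r → Module.End ℝ (eigenspace (A 0) μ) := fun i =>
    ((μ ^ 2)⁻¹ • (A 1 ∘ₗ A i.succ.succ)).restrict (maps i)
  have hT : ∀ i x, (T i x : E) = (μ ^ 2)⁻¹ • A 1 (A i.succ.succ x) := fun i x => rfl
  have one_ne : ∀ i : Fin r, i.succ.succ ≠ 1 := fun i h => by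
    have := congrArg Fin.val h
    simp at this
  -- Since A_1 anticommutes with A_{i+2}, T_i T_j = -μ⁻⁴ A_1² A_{i+2} A_{j+2}; both relations follow
  -- from this.
  have hTT : ∀ i j x, (T i (T j x) : E) = -((μ ^ 2)⁻¹ • (μ ^ 2)⁻¹ •
      A 1 (A 1 (A i.succ.succ (A j.succ.succ x)))) := fun i j x => by
    rw [hT, hT, map_smul, map_smul, hanti _ _ (one_ne i), map_neg, smul_neg, smul_neg]
  have hTsq : ∀ i, T i * T i = -1 := fun i => by
    ext x
    have hx := mem_eigenspace_iff.1 x.2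
    change (T i (T i x) : E) = -(x : E)
    rw [hTT, hsq i.succ.succ 0, hsq 1 0, hx, map_smul, hx]
    simp only [map_smul, hx, smul_smul]
    rw [show (μ ^ 2)⁻¹ * ((μ ^ 2)⁻¹ * (μ * μ * μ * μ)) = 1 by field_simp, one_smul]
  have hTanti : ∀ i j, i ≠ j → T i * T j = -(T j * T i) := fun i j hij => by
    ext x
    change (T i (T j x) : E) = -(T j (T i x) : E)
    rw [hTT, hTT, hanti i.succ.succ j.succ.succ (by simpa using hij)]
    simp
  have := cliffordM_dvd_finrank r (fun i => if h : i < r then T ⟨i, h⟩ else 0) ⊤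
    (fun _ _ _ _ => Submodule.mem_top) (fun i hi => by simp [hi, hTsq]) fun i j hj hi => by
      have hj' : j < r := hj.trans hi
      simp only [hi, hj', dif_pos]
      exact hTanti _ _ (by simpa using hj.ne')
  rwa [finrank_top] at this

lemma count_map_eigenvalues {N : ℕ} {A : E →ₗ[ℝ] E} (hA : A.IsSymmetric)
    (hN : Module.finrank ℝ E = N) (μ : ℝ) :
    (Finset.univ.val.map (hA.eigenvalues hN)).count μ = Module.finrank ℝ (eigenspace A μ) := by
  rw [← hA.card_filter_eigenvalues_eq hN μ, Multiset.count_map]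
  simp [Finset.card, Finset.filter_val, eq_comm]

/-- If the eigenvalues of a symmetric `A` are a permutation of `w`, then `⟪A x, x⟫` is the diagonal
form with coefficients `w` in suitable orthonormal coordinates. -/
lemma exists_linearIsometryEquiv_inner_map_self {N : ℕ} {A : E →ₗ[ℝ] E} (hA : A.IsSymmetric)
    (hN : Module.finrank ℝ E = N) (w : Fin N → ℝ)
    (h : Finset.univ.val.map (hA.eigenvalues hN) = Finset.univ.val.map w) :
    ∃ G : E ≃ₗᵢ[ℝ] EuclideanSpace ℝ (Fin N), ∀ x, inner ℝ (A x) x = ∑ i, w i * G x i ^ 2 := by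
  obtain ⟨σ, hσ⟩ := exists_perm_of_map_eq _ _ h
  let v := hA.eigenvectorBasis hN
  refine ⟨(v.reindex σ).repr, fun x => ?_⟩
  rw [← v.sum_inner_mul_inner, ← Equiv.sum_comp σ fun i => w i * (v.reindex σ).repr x i ^ 2]
  refine Finset.sum_congr rfl fun i _ => ?_
  rw [OrthonormalBasis.repr_apply_apply, OrthonormalBasis.reindex_apply, Equiv.symm_apply_apply,
    hσ, hA, hA.apply_eigenvectorBasis hN, inner_smul_right, real_inner_comm x]
  simp
  ring

end CliffordSystems

/-! ### Assembling the theorem. -/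

lemma directSumFun_quadF0 (k m : ℕ) (c : Fin k → ℝ) (x : EuclideanSpace ℝ (Fin (k * (2 * m)))) :
    directSumFun (fun j y => c j * quadF0 m y) x =
      ∑ t, (if (finProdFinEquiv.symm t).2.val < m then c (finProdFinEquiv.symm t).1
        else -c (finProdFinEquiv.symm t).1) * x t ^ 2 := by
  rw [← Equiv.sum_comp finProdFinEquiv, Fintype.sum_prod_type, directSumFun]
  refine Finset.sum_congr rfl fun j _ => ?_
  rw [quadF0, Finset.mul_sum]
  refine Finset.sum_congr rfl fun i _ => ?_
  simp only [Equiv.symm_apply_apply, euclideanBlock]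
  split_ifs <;> ring

theorem theorem5p2 (n k : ℕ) (hn : 1 ≤ n)
    (φ : EuclideanSpace ℝ (Fin (k * (2 * cliffordM n))) → EuclideanSpace ℝ (Fin (n + 1)))
    (hφ : IsQuadraticHarmonicMorphism φ) (hφ0 : φ ≠ 0) :
    ∃ (c : Fin k → ℝ) (ψ : EuclideanSpace ℝ (Fin (k * (2 * cliffordM n))) →
        EuclideanSpace ℝ (Fin (n + 1))),
      (∀ j, 0 ≤ c j) ∧ (∃ j, c j ≠ 0) ∧ DomainEquivalent φ ψ ∧
        ArisesFrom ψ (directSumFun fun j x => c j * quadF0 (cliffordM n) x) := by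
  obtain ⟨r, rfl⟩ := Nat.exists_eq_add_of_le' hn
  obtain ⟨hφm, hφq⟩ := hφ
  choose A hA hAφ using fun a => (hφq a).exists_isSymmetric
  have hanti := fun a b (hab : a ≠ b) => hφm.anticommute hA hAφ hab
  have hsq := hφm.sq_eq hA hAφ
  have hN : Module.finrank ℝ (EuclideanSpace ℝ (Fin (k * (2 * cliffordM (r + 1))))) =
      k * (2 * cliffordM (r + 1)) := by simp
  have h01 : (0 : Fin (r + 2)) ≠ 1 := by simp
  have heig : ∀ a, Finset.univ.val.map ((hA a).eigenvalues hN) =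
      Finset.univ.val.map ((hA 0).eigenvalues hN) := fun a => by
    rcases eq_or_ne a 0 with rfl | ha
    · rfl
    · ext μ
      rw [count_map_eigenvalues, count_map_eigenvalues]
      exact le_antisymm (finrank_eigenspace_le (hA 0) (hanti a 0 ha) (hsq a 0) μ)
        (finrank_eigenspace_le (hA a) (hanti 0 a ha.symm) (hsq 0 a) μ)
  obtain ⟨c, hc, hcsum⟩ := exists_eq_sum_replicate (m := cliffordM (r + 1)) k
    (Finset.univ.val.map ((hA 0).eigenvalues hN)) (by simp)
    (fun μ hμ => by
      rw [count_map_eigenvalues, count_map_eigenvalues,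
        finrank_eigenspace_neg (hanti 0 1 h01) (hsq 0 1) hμ])
    (fun μ hμ => by
      rw [count_map_eigenvalues]
      exact cliffordM_dvd_finrank_eigenspace r A hanti hsq hμ)
  rw [← map_univ_block_signs] at hcsum
  choose G hG using fun a => exists_linearIsometryEquiv_inner_map_self (hA a) hN _
    ((heig a).trans hcsum)
  have hF : ∀ a x, φ x a =
      directSumFun (fun j y => c j * quadF0 (cliffordM (r + 1)) y) (G a x) := fun a x => by
    rw [directSumFun_quadF0, hAφ, hG]
  -- Composing with G_0⁻¹ makes the first component F itself; the others become F ∘ (G_i ∘ G_0⁻¹).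
  refine ⟨c, φ ∘ (G 0).symm, hc, ?_, ⟨G 0, ?_⟩, fun x => ?_, fun i => ⟨(G 0).symm.trans (G i.succ),
    fun x => ?_⟩⟩
  · by_contra! hc0
    refine hφ0 (funext fun x => ?_)
    ext a
    rw [hF]
    simp [directSumFun, hc0]
  · ext x : 1
    simp
  · simp [hF]
  · simp [hF]
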